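/- **Conventions.** A *contour* $\mathcal C$ is given by a continuous $c:[0,1]\to\mathbb C$ which has a continuous derivative except at finitely many points and has finite length ($c'$ is integrable on $[0,1]$); $\int_{\mathcal C} f(z)\,dz:=\int_0^1 f(c(t))c'(t)\,dt$. A *domain* is a nonempty connected open set. Arguments are taken in $(-\pi,\pi]$, and powers of nonzero complex numbers are principal values $z^\tau=e^{\tau\log z}$. **Setting.** Let $\mathcal C$ be a contour, $z_0\in\mathbb C$, $\mathcal B$ a neighborhood of $z_0$, and let $p$ be holomorphic on a domain containing $\mathcal B\cup\mathcal C$. Let $\mu\ge 1$ be an even integer, $p_0\in\mathbb C$ nonzero, and $\phi$ holomorphic on $\mathcal B$ with $\phi(z_0)=0$, such that $$p(z)=p(z_0)-p_0(z-z_0)^\mu(1-\phi(z))\qquad(z\in\mathcal B).$$ Put $\theta_\ell:=-\frac{\arg(p_0)}{\mu}+\frac{2\pi \ell}{\mu}$ for $\ell\in\mathbb Z$. Suppose that $\mathcal C$ begins at $z_1$, passes through $z_0$ exactly once and ends at $z_2$, where $z_0,z_1,z_2$ are distinct, and that $$\operatorname{Re}(p(z))<\operatorname{Re}(p(z_0))\quad\text{for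 all } z\in\mathcal C,\ z\ne z_0.$$ Let $k,n\in\mathbb Z$ be such that $\mathcal C$ approaches $z_0$ in the sector of angular width $2\pi/\mu$ about $z_0$ with bisecting angle $\theta_k+(2n+1)\pi$, and initially leaves $z_0$ in the sector of angular width $2\pi/\mu$ about $z_0$ with bisecting angle $\theta_k$. **Corollary 5.1 (Perron's method for a holomorphic integrand with contour passing through a maximum between opposite sectors).** For every integer $M\ge 0$ there are constants $C$ and $N_0$ such that the following holds for every function $q$ holomorphic on a domain containing $\mathcal B\cup\mathcal C$, every bound $K_q$ for $|q(z)|$ on $\mathcal B\cup\mathcal C$, and every real $N>0$ with $N\ge N_0$: $$\int_{\mathcal C} e^{N p(z)}q(z)\,dz=e^{N p(z_0)}\left(\sum_{m=0}^{M-1}\Gamma\!\left(\frac{2m+1}{\mu}\right)\frac{2\alpha_{2m}\,e^{2\pi i k(2m+1)/\mu}}{N^{(2m+1)/\mu}}+E\right),\qquad |E|\le \frac{C\,K_q}{N^{(2M+1)/\mu}},$$ where $$\alpha_s=\frac{1}{\mu\, s!}\,p_0^{-(s+1)/\mu}\,\frac{d^s}{dz^s}\Big\{q(z)\,(1-\phi(z))^{-(s+1)/\mu}\Big\}_{z=z_0}.$$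 In particular $C$ and $N_0$ do not depend on $N$ or $q$. -/

import Mathlib

open Set Filter Topology

namespace Perron

/-- Contours of integration: continuous maps on `[0,1]` with a continuous derivative except at
finitely many points, and of finite length (the derivative is integrable on `[0,1]`).
Only the values of `c` on `[0,1]` matter; the endpoints count as exceptional points. -/
structure IsContour (c : ℝ → ℂ) : Prop where
  continuousOn : ContinuousOn c (Icc 0 1)
  continuous_deriv : ∃ F : Set ℝ, F.Finite ∧
    ∀ t ∈ Ioo (0 : ℝ) 1 \ F, DifferentiableAt ℝ c t ∧ ContinuousAt (deriv c) t
  finite_length : IntervalIntegrable (deriv c) MeasureTheory.volume 0 1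

/-- The set of points on the contour. -/
def trace (c : ℝ → ℂ) : Set ℂ := c '' Icc 0 1

/-- The integral of `f` along the contour `c`. -/
noncomputable def contourIntegral (c : ℝ → ℂ) (f : ℂ → ℂ) : ℂ :=
  ∫ t in (0 : ℝ)..1, f (c t) * deriv c t

/-- A domain: a nonempty connected open subset of the plane. -/
def IsPlaneDomain (U : Set ℂ) : Prop := IsOpen U ∧ IsConnected U

/-- The steepest-descent angle `θ_ℓ = -ω₀ / μ + 2 π ℓ / μ`, where `ω₀ = arg p₀ ∈ (-π, π]`. -/
noncomputable def steepestAngle (μ : ℕ) (p₀ : ℂ) (l : ℤ) : ℝ :=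
  -(Complex.arg p₀) / μ + 2 * Real.pi * l / μ

/-- The (closed) sector with vertex `z₀`, bisecting angle `β` and angular width `w`. -/
def sector (z₀ : ℂ) (β w : ℝ) : Set ℂ :=
  {z | ∃ r θ : ℝ, 0 ≤ r ∧ |θ - β| ≤ w / 2 ∧ z = z₀ + r * Complex.exp (θ * Complex.I)}

/-- The expansion coefficients
`α_s = (1 / (μ s!)) p₀ ^ (-(s+1)/μ) (d/dz)^s {q(z) (1 - φ(z)) ^ (-(s+1)/μ)}` at `z = z₀`,
with principal values of the powers. -/
noncomputable def coeff (μ : ℕ) (p₀ : ℂ) (φ q : ℂ → ℂ) (z₀ : ℂ) (s : ℕ) : ℂ :=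
  1 / ((μ : ℂ) * (s.factorial : ℂ)) * p₀ ^ (-((s : ℂ) + 1) / (μ : ℂ)) *
    iteratedDeriv s (fun z => q z * (1 - φ z) ^ (-((s : ℂ) + 1) / (μ : ℂ))) z₀

end Perron

namespace Perron

/-! ### Laplace integrals of monomials -/

/-! This is Laplace's method. Away from `z₀` the contour is compact and `Re p` stays below `Re
p(z₀)` by a fixed gap, so those parts are exponentially small relative to `e^{N p(z₀)}`. Near `z₀`
the coordinate `w = (z - z₀) p₀^{1/μ} (1 - φ)^{1/μ}` turns `p` into exactly `p(z₀) - w^μ`, with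
local inverse `g` (`exists_local_inverse`).

The integrand has a primitive on a disc about `z₀`. The middle part of the contour therefore depends
only on its two ends and may be replaced by the `g`-images of two straight segments meeting at `w =
0` (`sub_eq_segment_integral`). These need not be steepest-descent paths: `Re (w^μ) > 0` at the ends
suffices, and that is `Re p < Re p(z₀)` there. Watson's lemma
(`exists_norm_segment_integral_sub_le`) expands each segment integral, and Lagrange inversion
(`taylor_coeff_comp_inverse`) identifies the coefficients.

The sectors select the branch of `(N w^μ)^{1/μ}`, hence the phases. The two directions differ by an
odd multiple of `π`, so the odd-index terms cancel and the even-index terms double. The integrand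
`q` enters only through Taylor bounds linear in `K`, which gives the uniformity. -/

theorem integrableOn_pow_mul_exp_neg {μ : ℕ} (hμ : μ ≠ 0) (s : ℕ) {b : ℝ} (hb : 0 < b) :
    MeasureTheory.IntegrableOn (fun t : ℝ => t ^ s * Real.exp (-b * t ^ μ)) (Ioi 0) := by
  have h := integrableOn_rpow_mul_exp_neg_mul_rpow (p := (μ : ℝ)) (s := (s : ℝ)) (b := b)
    (by have : (0 : ℝ) ≤ s := s.cast_nonneg
        linarith) (by positivity) hb
  simpa only [Real.rpow_natCast] using h

theorem integral_pow_mul_exp_neg {μ : ℕ} (hμ : μ ≠ 0) (s : ℕ) {b : ℝ} (hb : 0 < b) :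
    ∫ t in Ioi (0 : ℝ), t ^ s * Real.exp (-b * t ^ μ) =
      b ^ (-((s : ℝ) + 1) / μ) * (1 / μ) * Real.Gamma (((s : ℝ) + 1) / μ) := by
  have h := integral_rpow_mul_exp_neg_mul_rpow (p := (μ : ℝ)) (q := (s : ℝ)) (b := b)
    (by positivity) (by have : (0 : ℝ) ≤ s := s.cast_nonneg
                        linarith) hb
  simpa only [Real.rpow_natCast] using h

/-- The integrand of the Laplace integral `∫₀^∞ t ^ s exp (-r t ^ μ) dt`. -/
noncomputable def laplaceKernel (μ s : ℕ) (r : ℂ) (t : ℝ) : ℂ :=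
  (t : ℂ) ^ s * Complex.exp (-r * (t : ℂ) ^ μ)

theorem continuous_laplaceKernel (μ s : ℕ) (r : ℂ) : Continuous (laplaceKernel μ s r) := by
  unfold laplaceKernel
  fun_prop

theorem norm_laplaceKernel (μ s : ℕ) (r : ℂ) {t : ℝ} (ht : 0 ≤ t) :
    ‖laplaceKernel μ s r t‖ = t ^ s * Real.exp (-r.re * t ^ μ) := by
  have h : (-r * (t : ℂ) ^ μ).re = -r.re * t ^ μ := by
    rw [← Complex.ofReal_pow, Complex.re_mul_ofReal, Complex.neg_re]
  rw [laplaceKernel, norm_mul, norm_pow, Complex.norm_real, Complex.norm_exp, h,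
    Real.norm_of_nonneg ht]

theorem integrableOn_laplaceKernel {μ : ℕ} (hμ : μ ≠ 0) (s : ℕ) {r : ℂ} (hr : 0 < r.re) :
    MeasureTheory.IntegrableOn (laplaceKernel μ s r) (Ioi 0) := by
  refine (integrableOn_pow_mul_exp_neg hμ s hr).mono'
    (continuous_laplaceKernel μ s r).aestronglyMeasurable ?_
  filter_upwards [MeasureTheory.ae_restrict_mem measurableSet_Ioi] with t ht
  exact (norm_laplaceKernel μ s r (le_of_lt ht)).le

/-- Differentiating in `r` brings down `-t ^ μ`, which raises `s` to `s + μ`. On the ball of radius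
`r.re / 2` the real part stays above `r.re / 2`, which supplies the dominating function. -/
theorem hasDerivAt_integral_laplaceKernel {μ : ℕ} (hμ : μ ≠ 0) (s : ℕ) {r : ℂ} (hr : 0 < r.re) :
    HasDerivAt (fun r => ∫ t in Ioi (0 : ℝ), laplaceKernel μ s r t)
      (∫ t in Ioi (0 : ℝ), -laplaceKernel μ (s + μ) r t) r := by
  have hr2 : 0 < r.re / 2 := by positivity
  refine (hasDerivAt_integral_of_dominated_loc_of_deriv_le
    (μ := MeasureTheory.volume.restrict (Ioi (0 : ℝ)))
    (F := fun r t => laplaceKernel μ s r t) (F' := fun r t => -laplaceKernel μ (s + μ) r t)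
    (bound := fun t : ℝ => t ^ (s + μ) * Real.exp (-(r.re / 2) * t ^ μ))
    (Metric.ball_mem_nhds r hr2) (Eventually.of_forall fun x =>
      (continuous_laplaceKernel μ s x).aestronglyMeasurable)
    (integrableOn_laplaceKernel hμ s hr)
    (continuous_laplaceKernel μ (s + μ) r).neg.aestronglyMeasurable
    ?_ (integrableOn_pow_mul_exp_neg hμ _ hr2) ?_).2
  · filter_upwards [MeasureTheory.ae_restrict_mem measurableSet_Ioi] with t ht x hx
    have ht0 : (0 : ℝ) < t := ht
    rw [norm_neg, norm_laplaceKernel _ _ _ ht0.le]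
    have hx' : r.re / 2 ≤ x.re := by
      have h1 := (Complex.abs_re_le_norm (x - r)).trans (mem_ball_iff_norm.1 hx).le
      rw [Complex.sub_re, abs_le] at h1
      linarith
    gcongr
  · refine Eventually.of_forall fun t x _ => ?_
    have h := (((hasDerivAt_id x).neg.mul_const ((t : ℂ) ^ μ)).cexp).const_mul ((t : ℂ) ^ s)
    refine h.congr_deriv ?_
    simp only [laplaceKernel, id, Pi.neg_apply]
    ring

/-- Both sides are holomorphic on the right half-plane and agree on the positive reals, so the
identity theorem applies. Complex `r` is needed because `N * w ^ μ` is in general not real. -/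
theorem integral_laplaceKernel {μ : ℕ} (hμ : μ ≠ 0) (s : ℕ) {r : ℂ} (hr : 0 < r.re) :
    ∫ t in Ioi (0 : ℝ), laplaceKernel μ s r t =
      r ^ (-((s : ℂ) + 1) / μ) * (1 / μ) * (Real.Gamma (((s : ℝ) + 1) / μ) : ℂ) := by
  set H : Set ℂ := {z | 0 < z.re} with hH
  have hHo : IsOpen H := isOpen_lt continuous_const Complex.continuous_re
  have h1 : AnalyticOnNhd ℂ (fun r => ∫ t in Ioi (0 : ℝ), laplaceKernel μ s r t) H :=
    DifferentiableOn.analyticOnNhd (fun z hz =>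
      (hasDerivAt_integral_laplaceKernel hμ s hz).differentiableAt.differentiableWithinAt) hHo
  have h2 : AnalyticOnNhd ℂ (fun r : ℂ =>
      r ^ (-((s : ℂ) + 1) / μ) * (1 / μ) * (Real.Gamma (((s : ℝ) + 1) / μ) : ℂ)) H := by
    refine DifferentiableOn.analyticOnNhd (fun z hz => ?_) hHo
    refine DifferentiableAt.differentiableWithinAt ?_
    have hz' : z ∈ Complex.slitPlane := Or.inl hz
    exact ((differentiableAt_id.cpow_const hz').mul_const _).mul_const _
  have hpre : IsPreconnected H := (convex_halfSpace_re_gt 0).isPreconnected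
  refine h1.eqOn_of_preconnected_of_frequently_eq h2 hpre (z₀ := 1) (by simp [hH]) ?_ hr
  have hreal : ∀ b : ℝ, 0 < b → ∫ t in Ioi (0 : ℝ), laplaceKernel μ s b t =
      (b : ℂ) ^ (-((s : ℂ) + 1) / μ) * (1 / μ) * (Real.Gamma (((s : ℝ) + 1) / μ) : ℂ) := by
    intro b hb
    have h3 := congrArg (fun x : ℝ => (x : ℂ)) (integral_pow_mul_exp_neg hμ s hb)
    simp only [← integral_complex_ofReal, Complex.ofReal_mul, Complex.ofReal_cpow hb.le] at h3
    push_cast at h3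
    simpa only [laplaceKernel] using h3
  have htend : Tendsto (fun m : ℕ => ((1 + 1 / ((m : ℝ) + 1) : ℝ) : ℂ)) atTop (𝓝[≠] 1) := by
    refine tendsto_nhdsWithin_iff.2 ⟨?_, Eventually.of_forall fun m => ?_⟩
    · have := (tendsto_one_div_add_atTop_nhds_zero_nat (𝕜 := ℝ)).const_add 1
      rw [add_zero] at this
      have h := (Complex.continuous_ofReal.tendsto 1).comp this
      rw [Complex.ofReal_one] at h
      exact h
    · have : (0 : ℝ) < 1 / ((m : ℝ) + 1) := by positivity
      simp only [mem_compl_iff, mem_singleton_iff]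
      intro h
      have h' : (1 + 1 / ((m : ℝ) + 1) : ℝ) = 1 := by exact_mod_cast h
      linarith
  refine htend.frequently (Frequently.of_forall fun m => hreal _ ?_)
  positivity

/-- Watson's lemma along a segment `[0, w]` with `Re (w ^ μ) > 0`, uniformly in the integrand. -/
theorem exists_norm_segment_integral_sub_le {μ : ℕ} (hμ : μ ≠ 0) (S : ℕ) {w : ℂ} {ρ : ℝ}
    (hwρ : ‖w‖ < ρ) (hw : 0 < (w ^ μ).re) :
    ∃ C : ℝ, ∀ (F G : ℂ → ℂ) (a : ℕ → ℂ) (L N : ℝ), 0 < N →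
      ContinuousOn F (Metric.ball 0 ρ) →
      (∀ z ∈ Metric.ball (0 : ℂ) ρ, F z = ∑ s ∈ Finset.range S, a s * z ^ s + z ^ S * G z) →
      (∀ z ∈ Metric.ball (0 : ℂ) ρ, ‖G z‖ ≤ L) → (∀ s < S, ‖a s‖ ≤ L) →
      ‖(∫ t in (0 : ℝ)..1, Complex.exp (-N * (t * w) ^ μ) * F (t * w) * w) -
        ∑ s ∈ Finset.range S, a s * (w ^ (s + 1) *
          ((N * w ^ μ) ^ (-((s : ℂ) + 1) / μ) * (1 / μ) *
            (Real.Gamma (((s : ℝ) + 1) / μ) : ℂ)))‖ ≤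
        C * (L / N ^ (((S : ℝ) + 1) / μ)) := by
  set D : ℝ := (∑ s ∈ Finset.range S, ‖w‖ ^ s + ‖w‖ ^ S) * ‖w‖ with hD
  set A : ℝ := (w ^ μ).re with hA
  refine ⟨D * (A ^ (-((S : ℝ) + 1) / μ) * (1 / μ) * Real.Gamma (((S : ℝ) + 1) / μ)), ?_⟩
  intro F G a L N hN hFc hF hG ha
  have hρ : 0 < ρ := (norm_nonneg w).trans_lt hwρ
  have hL : 0 ≤ L := (norm_nonneg _).trans (hG 0 (Metric.mem_ball_self hρ))
  have hmem : ∀ t : ℝ, 0 ≤ t → t ≤ 1 → (t : ℂ) * w ∈ Metric.ball (0 : ℂ) ρ := by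
    intro t h0 h1
    rw [mem_ball_zero_iff, norm_mul, Complex.norm_real, Real.norm_of_nonneg h0]
    exact (mul_le_of_le_one_left (norm_nonneg w) h1).trans_lt hwρ
  have hr : ((N : ℂ) * w ^ μ).re = N * A := by rw [Complex.re_ofReal_mul]
  have hr0 : 0 < ((N : ℂ) * w ^ μ).re := by rw [hr]; positivity
  set f : ℝ → ℂ := fun t => Complex.exp (-N * (t * w) ^ μ) * F (t * w) * w with hf
  have hfint : MeasureTheory.IntegrableOn f (Ioc 0 1) := by
    have : ContinuousOn f (Icc 0 1) := by
      have h1 : ContinuousOn (fun t : ℝ => F ((t : ℂ) * w)) (Icc 0 1) :=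
        hFc.comp (by fun_prop) fun t ht => hmem t ht.1 ht.2
      exact ((Continuous.continuousOn (by fun_prop)).mul h1).mul continuousOn_const
    exact this.integrableOn_Icc.mono_set Ioc_subset_Icc_self
  have e1 : ∫ t in (0 : ℝ)..1, f t = ∫ t in Ioi (0 : ℝ), (Ioc (0 : ℝ) 1).indicator f t := by
    rw [intervalIntegral.integral_of_le zero_le_one,
      MeasureTheory.setIntegral_indicator measurableSet_Ioc]
    congr 2
    exact (inter_eq_right.2 Ioc_subset_Ioi_self).symm
  have i1 : MeasureTheory.IntegrableOn ((Ioc (0 : ℝ) 1).indicator f) (Ioi 0) :=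
    (hfint.integrable_indicator measurableSet_Ioc).integrableOn
  have e2 : ∑ s ∈ Finset.range S, a s * (w ^ (s + 1) *
          ((N * w ^ μ) ^ (-((s : ℂ) + 1) / μ) * (1 / μ) *
            (Real.Gamma (((s : ℝ) + 1) / μ) : ℂ))) =
      ∫ t in Ioi (0 : ℝ), ∑ s ∈ Finset.range S,
        a s * (w ^ (s + 1) * laplaceKernel μ s (N * w ^ μ) t) := by
    rw [MeasureTheory.integral_finsetSum]
    · refine Finset.sum_congr rfl fun s _ => ?_
      rw [MeasureTheory.integral_const_mul, MeasureTheory.integral_const_mul,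
        integral_laplaceKernel hμ s hr0]
    · intro s _
      exact ((integrableOn_laplaceKernel hμ s hr0).const_mul _).const_mul _
  have i2 : MeasureTheory.IntegrableOn (fun t => ∑ s ∈ Finset.range S,
        a s * (w ^ (s + 1) * laplaceKernel μ s (N * w ^ μ) t)) (Ioi 0) :=
    MeasureTheory.integrable_finsetSum _ fun s _ =>
      ((integrableOn_laplaceKernel hμ s hr0).const_mul _).const_mul _
  rw [e1, e2, ← MeasureTheory.integral_sub i1 i2]
  have hNA : 0 < N * A := by positivity
  -- One bound serves both ranges: for `t ≤ 1` the difference is the Taylor remainder, and for `t >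
  -- 1` only the tails of the monomial integrals remain, where `t ^ s ≤ t ^ S`.
  have hb : ∀ t ∈ Ioi (0 : ℝ), ‖(Ioc (0 : ℝ) 1).indicator f t - ∑ s ∈ Finset.range S,
        a s * (w ^ (s + 1) * laplaceKernel μ s (N * w ^ μ) t)‖ ≤
      D * L * (t ^ S * Real.exp (-(N * A) * t ^ μ)) := by
    intro t ht
    have ht0 : (0 : ℝ) < t := ht
    by_cases h1 : t ≤ 1
    · have heq : (Ioc (0 : ℝ) 1).indicator f t - ∑ s ∈ Finset.range S,
          a s * (w ^ (s + 1) * laplaceKernel μ s (N * w ^ μ) t) =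
          laplaceKernel μ S (N * w ^ μ) t * (w ^ S * G (t * w) * w) := by
        rw [indicator_of_mem (show t ∈ Ioc (0 : ℝ) 1 from ⟨ht0, h1⟩), hf]
        simp only
        rw [hF _ (hmem t ht0.le h1), mul_add, add_mul, Finset.mul_sum, Finset.sum_mul,
          add_sub_right_comm, ← Finset.sum_sub_distrib, Finset.sum_eq_zero, zero_add]
        · simp only [laplaceKernel]
          rw [show -(N : ℂ) * (t * w) ^ μ = -(N * w ^ μ) * (t : ℂ) ^ μ by ring]
          ring
        · intro s _
          simp only [laplaceKernel]
          rw [show -(N : ℂ) * (t * w) ^ μ = -(N * w ^ μ) * (t : ℂ) ^ μ by ring]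
          ring
      rw [heq, norm_mul, norm_laplaceKernel _ _ _ ht0.le, hr, mul_comm]
      gcongr
      rw [norm_mul, norm_mul, norm_pow, hD]
      have := hG _ (hmem t ht0.le h1)
      have h3 : 0 ≤ ∑ s ∈ Finset.range S, ‖w‖ ^ s := by positivity
      calc ‖w‖ ^ S * ‖G (t * w)‖ * ‖w‖ ≤ ‖w‖ ^ S * L * ‖w‖ := by gcongr
        _ ≤ (∑ s ∈ Finset.range S, ‖w‖ ^ s + ‖w‖ ^ S) * L * ‖w‖ := by
            gcongr
            linarith
        _ = _ := by ring
    · rw [indicator_of_notMem (fun h => h1 h.2), zero_sub, norm_neg]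
      push Not at h1
      refine (norm_sum_le _ _).trans ?_
      have h4 : ∀ s ∈ Finset.range S, ‖a s * (w ^ (s + 1) * laplaceKernel μ s (N * w ^ μ) t)‖ ≤
          L * (‖w‖ ^ (s + 1) * (t ^ S * Real.exp (-(N * A) * t ^ μ))) := by
        intro s hs
        rw [Finset.mem_range] at hs
        rw [norm_mul, norm_mul, norm_laplaceKernel _ _ _ ht0.le, hr, norm_pow]
        have := ha s hs
        have h5 : t ^ s ≤ t ^ S := pow_le_pow_right₀ h1.le hs.le
        gcongr
      refine (Finset.sum_le_sum h4).trans ?_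
      rw [← Finset.mul_sum, ← Finset.sum_mul, hD]
      have h6 : ∑ s ∈ Finset.range S, ‖w‖ ^ (s + 1) ≤
          (∑ s ∈ Finset.range S, ‖w‖ ^ s + ‖w‖ ^ S) * ‖w‖ := by
        rw [add_mul, Finset.sum_mul]
        simp only [pow_succ]
        have : 0 ≤ ‖w‖ ^ S * ‖w‖ := by positivity
        linarith
      calc L * ((∑ s ∈ Finset.range S, ‖w‖ ^ (s + 1)) * (t ^ S * Real.exp (-(N * A) * t ^ μ)))
          ≤ L * ((∑ s ∈ Finset.range S, ‖w‖ ^ s + ‖w‖ ^ S) * ‖w‖ *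
              (t ^ S * Real.exp (-(N * A) * t ^ μ))) := by gcongr
        _ = _ := by ring
  refine (MeasureTheory.norm_integral_le_of_norm_le
    ((integrableOn_pow_mul_exp_neg hμ S hNA).const_mul (D * L))
    ((MeasureTheory.ae_restrict_mem measurableSet_Ioi).mono hb)).trans (le_of_eq ?_)
  rw [MeasureTheory.integral_const_mul, integral_pow_mul_exp_neg hμ S hNA,
    Real.mul_rpow hN.le hw.le, neg_div, Real.rpow_neg hN.le]
  ring

/-! ### Taylor expansions with uniform remainder, and their coefficients -/

/-- Divided differences at `c` are iterated; by the Schwarz lemma each one costs a factor `2 / ρ` in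
the sup bound. All bounds are linear in `L`, as uniformity in `q` requires. -/
theorem exists_taylor_decomposition {c : ℂ} {ρ : ℝ} (hρ : 0 < ρ) (S : ℕ) :
    ∀ F : ℂ → ℂ, DifferentiableOn ℂ F (Metric.ball c ρ) →
    ∃ (b : ℕ → ℂ) (G : ℂ → ℂ), DifferentiableOn ℂ G (Metric.ball c ρ) ∧
      (∀ z ∈ Metric.ball c ρ,
        F z = ∑ s ∈ Finset.range S, b s * (z - c) ^ s + (z - c) ^ S * G z) ∧
      ∀ L : ℝ, (∀ z ∈ Metric.ball c ρ, ‖F z‖ ≤ L) →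
        (∀ z ∈ Metric.ball c ρ, ‖G z‖ ≤ (2 / ρ) ^ S * L) ∧ ∀ s < S, ‖b s‖ ≤ (2 / ρ) ^ s * L := by
  induction S with
  | zero => exact fun F hF => ⟨0, F, hF, by simp, fun L hL => ⟨by simpa using hL, by simp⟩⟩
  | succ S ih =>
    intro F hF
    obtain ⟨b, G, hG, he, hbd⟩ := ih (dslope F c)
      ((Complex.differentiableOn_dslope (Metric.ball_mem_nhds c hρ)).2 hF)
    refine ⟨fun s => Nat.casesOn s (F c) b, G, hG, fun z hz => ?_, fun L hL => ?_⟩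
    · have h1 : F z = F c + (z - c) * dslope F c z := by
        rw [← smul_eq_mul, sub_smul_dslope]
        ring
      rw [h1, he z hz, Finset.sum_range_succ', mul_add, Finset.mul_sum]
      have h2 : ∀ s ∈ Finset.range S, (z - c) * (b s * (z - c) ^ s) = b s * (z - c) ^ (s + 1) :=
        fun s _ => by ring
      rw [Finset.sum_congr rfl h2, pow_zero, mul_one, pow_succ', mul_assoc]
      exact (add_assoc _ _ _).symm.trans (congrArg (· + (z - c) * ((z - c) ^ S * G z))
        (add_comm _ _))
    · have hd : ∀ z ∈ Metric.ball c ρ, ‖dslope F c z‖ ≤ 2 / ρ * L := by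
        intro z hz
        -- The radius `L + L` bounds the distance from `F y` to `F c`.
        have := Complex.norm_dslope_le_div_of_mapsTo_ball (R₂ := L + L) hF (fun y hy => by
          rw [mem_closedBall_iff_norm]
          exact (norm_sub_le _ _).trans
            (add_le_add (hL y hy) (hL c (Metric.mem_ball_self hρ)))) hz
        exact this.trans (le_of_eq (by ring))
      obtain ⟨h3, h4⟩ := hbd _ hd
      refine ⟨fun z hz => (h3 z hz).trans (le_of_eq (by ring)), fun s hs => ?_⟩
      cases s with
      | zero => simpa using hL c (Metric.mem_ball_self hρ)
      | succ s => exact (h4 s (by omega)).trans (le_of_eq (by ring))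

/-- The residue of `(∑ bᵢ ψ ^ i + ψ ^ S T) ψ' / ψ ^ (s + 1)` at a simple zero `c` of `ψ` is
`b_s`. -/
theorem circleIntegral_coeff {c : ℂ} {r ρ : ℝ} (hr : 0 < r) (hrρ : r < ρ) {ψ κ T : ℂ → ℂ}
    (hψ : DifferentiableOn ℂ ψ (Metric.ball c ρ)) (hκ : DifferentiableOn ℂ κ (Metric.ball c ρ))
    (hT : DifferentiableOn ℂ T (Metric.ball c ρ))
    (hψκ : ∀ z ∈ Metric.ball c ρ, ψ z * κ z = z - c)
    (hκ0 : ∀ z ∈ Metric.ball c ρ, κ z ≠ 0) (b : ℕ → ℂ) {s S : ℕ} (hs : s < S) :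
    (∮ z in C(c, r), (∑ i ∈ Finset.range S, b i * ψ z ^ i + ψ z ^ S * T z) * deriv ψ z /
      ψ z ^ (s + 1)) = 2 * Real.pi * Complex.I * b s := by
  have hsub : Metric.closedBall c r ⊆ Metric.ball c ρ := Metric.closedBall_subset_ball hrρ
  have hsph : Metric.sphere c r ⊆ Metric.ball c ρ := Metric.sphere_subset_closedBall.trans hsub
  have hne : ∀ z ∈ Metric.sphere c r, z - c ≠ 0 := fun z hz h => by
    rw [mem_sphere_iff_norm, h, norm_zero] at hz
    exact hr.ne hz
  have hψne : ∀ z ∈ Metric.sphere c r, ψ z ≠ 0 := fun z hz h => by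
    have := hψκ z (hsph hz)
    rw [h, zero_mul] at this
    exact hne z hz this.symm
  have hψ' : DifferentiableOn ℂ (deriv ψ) (Metric.ball c ρ) := hψ.deriv Metric.isOpen_ball
  have hκ' : DifferentiableOn ℂ (deriv κ) (Metric.ball c ρ) := hκ.deriv Metric.isOpen_ball
  have zero_of_diff : ∀ f : ℂ → ℂ, DifferentiableOn ℂ f (Metric.ball c ρ) →
      (∮ z in C(c, r), f z) = 0 := fun f hf =>
    (hf.mono (by rw [closure_ball c hr.ne']; exact hsub)).diffContOnCl.circleIntegral_eq_zero hr.le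
  have hdψ : ∀ z ∈ Metric.sphere c r, HasDerivAt ψ (deriv ψ z) z := fun z hz =>
    (hψ.differentiableAt (Metric.isOpen_ball.mem_nhds (hsph hz))).hasDerivAt
  have hdκ : ∀ z ∈ Metric.sphere c r, HasDerivAt κ (deriv κ z) z := fun z hz =>
    (hκ.differentiableAt (Metric.isOpen_ball.mem_nhds (hsph hz))).hasDerivAt
  have hcont : ∀ m : ℤ, ContinuousOn (fun z => ψ z ^ m * deriv ψ z) (Metric.sphere c r) :=
    fun m => ((hψ.continuousOn.mono hsph).zpow₀ m fun z hz => Or.inl (hψne z hz)).mul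
      (hψ'.continuousOn.mono hsph)
  -- Away from `m = -1`, `ψ ^ m * ψ'` has the single-valued primitive `ψ ^ (m + 1) / (m + 1)`.
  have hpow : ∀ m : ℤ, m ≠ -1 → (∮ z in C(c, r), ψ z ^ m * deriv ψ z) = 0 := by
    intro m hm
    have hm' : (m : ℂ) + 1 ≠ 0 := by
      intro h
      apply hm
      have : ((m + 1 : ℤ) : ℂ) = 0 := by push_cast; exact h
      have := Int.cast_eq_zero.1 this
      omega
    refine circleIntegral.integral_eq_zero_of_hasDerivWithinAt
      (f := fun z => ((m : ℂ) + 1)⁻¹ * ψ z ^ (m + 1)) hr.le fun z hz => ?_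
    have h := ((hasDerivAt_zpow (m + 1) (ψ z) (Or.inl (hψne z hz))).comp z (hdψ z hz)).const_mul
      (((m : ℂ) + 1)⁻¹)
    refine (h.congr_deriv ?_).hasDerivWithinAt
    push_cast
    rw [add_sub_cancel_right]
    field_simp
  -- The logarithmic derivative of `ψ κ = z - c` gives `ψ' / ψ = 1 / (z - c) - κ' / κ`, where `κ' /
  -- κ` is holomorphic.
  have hone : (∮ z in C(c, r), ψ z ^ (-1 : ℤ) * deriv ψ z) = 2 * Real.pi * Complex.I := by
    have hq : DifferentiableOn ℂ (fun z => deriv κ z / κ z) (Metric.ball c ρ) := hκ'.div hκ hκ0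
    have h1 : (∮ z in C(c, r), ψ z ^ (-1 : ℤ) * deriv ψ z) =
        ∮ z in C(c, r), ((z - c)⁻¹ - deriv κ z / κ z) := by
      refine circleIntegral.integral_congr hr.le fun z hz => ?_
      have h2 : deriv ψ z * κ z + ψ z * deriv κ z = 1 := by
        have h3 := (hdψ z hz).mul (hdκ z hz)
        have h4 : HasDerivAt (ψ * κ) 1 z := by
          refine ((hasDerivAt_id z).sub_const c).congr_of_eventuallyEq ?_
          filter_upwards [Metric.isOpen_ball.mem_nhds (hsph hz)] with y hy
          exact hψκ y hy
        exact h3.unique h4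
      have h5 := hψne z hz
      have h6 := hκ0 z (hsph hz)
      simp only [zpow_neg, zpow_one]
      rw [← hψκ z (hsph hz)]
      field_simp
      linear_combination h2
    rw [h1, circleIntegral.integral_sub, circleIntegral.integral_sub_center_inv c hr.ne',
      zero_of_diff _ hq, sub_zero]
    · refine ContinuousOn.circleIntegrable hr.le ?_
      exact (by fun_prop : Continuous fun z : ℂ => z - c).continuousOn.inv₀ hne
    · exact (hq.continuousOn.mono hsph).circleIntegrable hr.le
  have hexp : (∮ z in C(c, r), (∑ i ∈ Finset.range S, b i * ψ z ^ i + ψ z ^ S * T z) *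
      deriv ψ z / ψ z ^ (s + 1)) =
      ∮ z in C(c, r), (∑ i ∈ Finset.range S, b i * (ψ z ^ ((i : ℤ) - (s + 1)) * deriv ψ z) +
        ψ z ^ (S - (s + 1)) * T z * deriv ψ z) := by
    refine circleIntegral.integral_congr hr.le fun z hz => ?_
    have h5 := hψne z hz
    rw [add_mul, add_div, Finset.sum_mul, Finset.sum_div]
    congr 1
    · refine Finset.sum_congr rfl fun i _ => ?_
      rw [zpow_sub₀ h5, zpow_natCast, ← Nat.cast_succ, zpow_natCast]
      field_simp
    · rw [show ψ z ^ S = ψ z ^ (S - (s + 1)) * ψ z ^ (s + 1) by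
        rw [← pow_add, Nat.sub_add_cancel hs]]
      field_simp
  have hTd : DifferentiableOn ℂ (fun z => ψ z ^ (S - (s + 1)) * T z * deriv ψ z)
      (Metric.ball c ρ) := ((hψ.pow _).mul hT).mul hψ'
  have hint : ∀ i ∈ Finset.range S, CircleIntegrable
      (fun z => b i * (ψ z ^ ((i : ℤ) - (s + 1)) * deriv ψ z)) c r := fun i _ =>
    ((hcont _).const_mul _).circleIntegrable hr.le
  rw [hexp, circleIntegral.integral_add, zero_of_diff _ hTd, add_zero,
    circleIntegral.integral_fun_sum hint, Finset.sum_eq_single s]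
  · rw [circleIntegral.integral_const_mul, show (s : ℤ) - (s + 1) = -1 by ring, hone]
    ring
  · intro i _ hi
    rw [circleIntegral.integral_const_mul, hpow _ (by omega), mul_zero]
  · intro h
    exact absurd (Finset.mem_range.2 hs) h
  · exact CircleIntegrable.fun_sum _ hint
  · exact (hTd.continuousOn.mono hsph).circleIntegrable hr.le

/-- Lagrange inversion: if `g` inverts `z ↦ (z - z₀) κ z` near `0`, the Taylor coefficients of
`(q ∘ g) g'` at `0` are derivatives of `q κ ^ (-(s + 1))` at `z₀`. -/
theorem taylor_coeff_comp_inverse {z₀ : ℂ} {R ρ : ℝ} (hR : 0 < R) (hρ : 0 < ρ) {g κ q : ℂ → ℂ}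
    (hg : DifferentiableOn ℂ g (Metric.ball 0 ρ))
    (hgR : MapsTo g (Metric.ball 0 ρ) (Metric.ball z₀ R))
    (hκ : DifferentiableOn ℂ κ (Metric.ball z₀ R)) (hκ0 : ∀ z ∈ Metric.ball z₀ R, κ z ≠ 0)
    (hq : DifferentiableOn ℂ q (Metric.ball z₀ R))
    (hgκ : ∀ w ∈ Metric.ball (0 : ℂ) ρ, (g w - z₀) * κ (g w) = w)
    {S : ℕ} {a : ℕ → ℂ} {G : ℂ → ℂ} (hG : DifferentiableOn ℂ G (Metric.ball 0 ρ))
    (ha : ∀ w ∈ Metric.ball (0 : ℂ) ρ,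
      q (g w) * deriv g w = ∑ s ∈ Finset.range S, a s * w ^ s + w ^ S * G w)
    {s : ℕ} (hs : s < S) :
    a s = (s.factorial : ℂ)⁻¹ * iteratedDeriv s (fun z => q z / κ z ^ (s + 1)) z₀ := by
  set Q : ℂ → ℂ := fun z => q z / κ z ^ (s + 1) with hQ
  have hQd : DifferentiableOn ℂ Q (Metric.ball z₀ R) :=
    hq.div (hκ.pow _) fun z hz => pow_ne_zero _ (hκ0 z hz)
  obtain ⟨b, T, hT, hQe, -⟩ := exists_taylor_decomposition hR S Q hQd
  have h2π : (2 * Real.pi * Complex.I : ℂ) ≠ 0 := Complex.two_pi_I_ne_zero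
  have hb : b s = (s.factorial : ℂ)⁻¹ * iteratedDeriv s Q z₀ := by
    have hr : 0 < R / 2 := by positivity
    have hsub : Metric.closedBall z₀ (R / 2) ⊆ Metric.ball z₀ R :=
      Metric.closedBall_subset_ball (by linarith)
    have h1 := (hQd.mono (show closure (Metric.ball z₀ (R / 2)) ⊆ _ by
      rw [closure_ball z₀ hr.ne']; exact hsub)).diffContOnCl.circleIntegral_one_div_sub_center_pow_smul
        hr s
    have h2 := circleIntegral_coeff (c := z₀) (ψ := fun z => z - z₀) (κ := fun _ => 1) hr
      (by linarith : R / 2 < R) (by fun_prop) (by fun_prop) hT (by simp) (by simp) b hs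
    have h3 : (∮ z in C(z₀, R / 2), (1 / (z - z₀) ^ (s + 1)) • Q z) =
        2 * Real.pi * Complex.I * b s := by
      rw [← h2]
      refine circleIntegral.integral_congr hr.le fun z hz => ?_
      have hd : deriv (fun z => z - z₀) z = 1 := by simp
      simp only [hd, smul_eq_mul]
      rw [hQe z (hsub (Metric.sphere_subset_closedBall hz))]
      ring
    rw [h1, smul_eq_mul] at h3
    apply mul_left_cancel₀ h2π
    rw [← h3]
    ring
  rw [← hb]
  have hr : 0 < ρ / 2 := by positivity
  have hsph : Metric.sphere (0 : ℂ) (ρ / 2) ⊆ Metric.ball 0 ρ :=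
    Metric.sphere_subset_closedBall.trans (Metric.closedBall_subset_ball (by linarith))
  -- Since `w = (g w - z₀) κ (g w)`, the same integral over one circle in the `w`-plane computes `a
  -- s` with `ψ = w` and `b s` with `ψ = g w - z₀`. The image of the circle under `g` never has to
  -- be studied.
  have h1 := circleIntegral_coeff (c := 0) (ψ := fun z => z) (κ := fun _ => 1) hr
    (by linarith : ρ / 2 < ρ) (by fun_prop) (by fun_prop) hG (by simp) (by simp) a hs
  have h2 := circleIntegral_coeff (c := 0) (ψ := fun w => g w - z₀) (κ := fun w => κ (g w)) hr
    (by linarith : ρ / 2 < ρ) (hg.sub_const z₀) (hκ.comp hg hgR) (hT.comp hg hgR)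
    (fun w hw => by rw [hgκ w hw, sub_zero]) (fun w hw => hκ0 _ (hgR hw)) b hs
  apply mul_left_cancel₀ h2π
  rw [← h1, ← h2]
  refine circleIntegral.integral_congr hr.le fun w hw => ?_
  have hw' := hsph hw
  have hκw := hκ0 _ (hgR hw')
  have hd : deriv (fun z : ℂ => z) w = 1 := by simp
  simp only [hd, deriv_sub_const, Function.comp_apply]
  rw [← ha w hw', ← hQe _ (hgR hw'), hQ]
  simp only
  have h3 : w ^ (s + 1) = (g w - z₀) ^ (s + 1) * κ (g w) ^ (s + 1) := by
    rw [← mul_pow, hgκ w hw']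
  rw [h3]
  field_simp

/-! ### The local coordinate and directions -/

/-- The derivative of `(z - z₀) κ z` at `z₀` is `κ z₀ ≠ 0`, so the inverse function theorem applies;
`ρ` is shrunk until `g` is holomorphic with bounded derivative. -/
theorem exists_local_inverse {z₀ : ℂ} {R : ℝ} (hR : 0 < R) {κ : ℂ → ℂ}
    (hκ : DifferentiableOn ℂ κ (Metric.ball z₀ R)) (hκ0 : κ z₀ ≠ 0) :
    ∃ ρ > 0, ∃ (g : ℂ → ℂ) (D : ℝ), DifferentiableOn ℂ g (Metric.ball 0 ρ) ∧
      MapsTo g (Metric.ball 0 ρ) (Metric.ball z₀ R) ∧ g 0 = z₀ ∧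
      (∀ w ∈ Metric.ball (0 : ℂ) ρ, (g w - z₀) * κ (g w) = w) ∧
      (∀ w ∈ Metric.ball (0 : ℂ) ρ, ‖deriv g w‖ ≤ D) ∧
      ∀ᶠ z in 𝓝 z₀, g ((z - z₀) * κ z) = z := by
  set h : ℂ → ℂ := fun z => (z - z₀) * κ z with hh
  have hκa : AnalyticAt ℂ κ z₀ := hκ.analyticAt (Metric.ball_mem_nhds z₀ hR)
  have ha : AnalyticAt ℂ h z₀ := (analyticAt_id.sub analyticAt_const).mul hκa
  have hh0 : h z₀ = 0 := by simp [hh]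
  have hd : deriv h z₀ ≠ 0 := by
    have : HasDerivAt h (κ z₀) z₀ := by
      have h1 := ((hasDerivAt_id z₀).sub_const z₀).mul hκa.differentiableAt.hasDerivAt
      refine h1.congr_deriv ?_
      simp
    rwa [this.deriv]
  set g := ha.hasStrictDerivAt.localInverse _ _ _ hd with hg
  have hga : AnalyticAt ℂ g 0 := by
    have := ha.analyticAt_localInverse hd
    rwa [hh0] at this
  have hg0 : g 0 = z₀ := by
    have : g (h z₀) = z₀ := HasStrictFDerivAt.localInverse_apply_image ..
    rwa [hh0] at this
  have hr : ∀ᶠ w in 𝓝 (0 : ℂ), h (g w) = w := by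
    have := HasStrictDerivAt.eventually_right_inverse ha.hasStrictDerivAt hd
    rwa [hh0] at this
  have hl : ∀ᶠ z in 𝓝 z₀, g (h z) = z :=
    HasStrictDerivAt.eventually_left_inverse ha.hasStrictDerivAt hd
  have hmaps : ∀ᶠ w in 𝓝 (0 : ℂ), g w ∈ Metric.ball z₀ R := by
    refine hga.continuousAt.eventually ?_
    rw [hg0]
    exact Metric.ball_mem_nhds z₀ hR
  have hbd : ∀ᶠ w in 𝓝 (0 : ℂ), ‖deriv g w‖ < ‖deriv g 0‖ + 1 :=
    hga.deriv.continuousAt.norm.eventually_lt_const (lt_add_one _)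
  obtain ⟨ρ, hρ, hall⟩ := Metric.eventually_nhds_iff_ball.1
    (hga.eventually_analyticAt.and (hr.and (hmaps.and hbd)))
  exact ⟨ρ, hρ, g, ‖deriv g 0‖ + 1,
    fun w hw => (hall w hw).1.differentiableAt.differentiableWithinAt,
    fun w hw => (hall w hw).2.2.1, hg0, fun w hw => (hall w hw).2.1,
    fun w hw => (hall w hw).2.2.2.le, hl⟩

theorem abs_lt_pi_div_two_of_cos_pos {x : ℝ} (hx : |x| < 3 * Real.pi / 2)
    (hcos : 0 < Real.cos x) : |x| < Real.pi / 2 := by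
  by_contra! h
  rw [← Real.cos_abs] at hcos
  exact absurd (Real.cos_nonpos_of_pi_div_two_le_of_le h (by linarith)) (not_le.2 hcos)

/-- The principal power in the Laplace integral, for an endpoint `w` in the direction
`β + δ`, where `β` is a direction in which `w ^ μ` is positive. -/
theorem pow_mul_cpow_of_direction {μ : ℕ} (hμ : μ ≠ 0) {w : ℂ} {r β δ N : ℝ} (hr : 0 < r)
    (hw : w = r * Complex.exp ((β + δ : ℝ) * Complex.I))
    (hβ : Complex.exp (μ * (β * Complex.I)) = 1) (hδ : |μ * δ| < 3 * Real.pi / 2)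
    (hre : 0 < (w ^ μ).re) (hN : 0 < N) (s : ℕ) :
    w ^ (s + 1) * (N * w ^ μ) ^ (-((s : ℂ) + 1) / μ) =
      Complex.exp (((s : ℂ) + 1) * (β * Complex.I)) / ((N ^ (((s : ℝ) + 1) / μ) : ℝ) : ℂ) := by
  have hμ0 : (0 : ℝ) < μ := by positivity
  have hwμ : w ^ μ = ((r ^ μ : ℝ) : ℂ) * Complex.exp ((μ * δ : ℝ) * Complex.I) := by
    rw [hw, mul_pow, ← Complex.exp_nat_mul]
    push_cast
    rw [show (μ : ℂ) * ((β + δ) * Complex.I) = μ * (β * Complex.I) + μ * δ * Complex.I by ring,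
      Complex.exp_add, hβ, one_mul]
  -- The sector only gives `3π/2`; positivity of `Re (w ^ μ)` improves it to `π/2`, which makes `x`
  -- below the principal `μ`-th root of `N * w ^ μ`.
  have hδ' : |μ * δ| < Real.pi / 2 := by
    refine abs_lt_pi_div_two_of_cos_pos hδ ?_
    rw [hwμ, Complex.re_ofReal_mul, Complex.exp_ofReal_mul_I_re] at hre
    exact pos_of_mul_pos_right hre (by positivity)
  set y : ℝ := N ^ ((μ : ℝ)⁻¹) with hy
  have hy0 : 0 < y := Real.rpow_pos_of_pos hN _
  have hyμ : y ^ μ = N := Real.rpow_inv_natCast_pow hN.le hμ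
  set x : ℂ := ((y * r : ℝ) : ℂ) * Complex.exp (δ * Complex.I) with hx
  have hx0 : x ≠ 0 := mul_ne_zero (by exact_mod_cast (mul_pos hy0 hr).ne') (Complex.exp_ne_zero _)
  have hxμ : x ^ μ = N * w ^ μ := by
    rw [hx, hwμ, mul_pow, ← Complex.exp_nat_mul, ← Complex.ofReal_pow, mul_pow, hyμ]
    push_cast
    rw [mul_assoc, mul_assoc (μ : ℂ)]
  rw [abs_lt] at hδ'
  have hlo : -(Real.pi / μ) < δ := by
    rw [neg_lt, lt_div_iff₀ hμ0]
    nlinarith [Real.pi_pos]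
  have hhi : δ ≤ Real.pi / μ := by
    rw [le_div_iff₀ hμ0]
    nlinarith [Real.pi_pos]
  have hπμ : Real.pi / μ ≤ Real.pi :=
    div_le_self Real.pi_pos.le (by exact_mod_cast Nat.one_le_iff_ne_zero.2 hμ)
  have harg : Complex.arg x = δ := by
    rw [hx, Complex.arg_real_mul _ (mul_pos hy0 hr), Complex.arg_exp_mul_I, toIocMod_eq_self]
    constructor <;> linarith
  have hroot : (N * w ^ μ) ^ ((μ : ℂ)⁻¹) = x := by
    rw [← hxμ]
    exact Complex.pow_cpow_nat_inv hμ (by rwa [harg]) (by rwa [harg])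
  have h1 : (N * w ^ μ) ^ (-((s : ℂ) + 1) / μ) = (x ^ (s + 1))⁻¹ := by
    rw [← hroot, ← Complex.cpow_nat_mul, ← Complex.cpow_neg]
    congr 1
    push_cast
    ring
  have h2 : w = x * (Complex.exp (β * Complex.I) / y) := by
    have : (y : ℂ) ≠ 0 := by exact_mod_cast hy0.ne'
    rw [hw, hx]
    push_cast
    rw [add_mul, Complex.exp_add]
    field_simp
  have h3 : N ^ (((s : ℝ) + 1) / μ) = y ^ (s + 1) := by
    rw [hy, ← Real.rpow_natCast, ← Real.rpow_mul hN.le]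
    congr 1
    push_cast
    ring
  rw [h1, h3, show w ^ (s + 1) = x ^ (s + 1) * (Complex.exp (β * Complex.I) / y) ^ (s + 1) by
    rw [← mul_pow, ← h2], div_pow, ← Complex.exp_nat_mul]
  have hx' := pow_ne_zero (s + 1) hx0
  push_cast
  field_simp

theorem exists_norm_segment_integral_sub_le_of_direction {μ : ℕ} (hμ : μ ≠ 0) (S : ℕ) {w : ℂ}
    {ρ r β δ : ℝ} (hwρ : ‖w‖ < ρ) (hre : 0 < (w ^ μ).re) (hr : 0 < r)
    (hw : w = r * Complex.exp ((β + δ : ℝ) * Complex.I))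
    (hβ : Complex.exp (μ * (β * Complex.I)) = 1) (hδ : |μ * δ| < 3 * Real.pi / 2) :
    ∃ C : ℝ, ∀ (F G : ℂ → ℂ) (a : ℕ → ℂ) (L N : ℝ), 0 < N →
      ContinuousOn F (Metric.ball 0 ρ) →
      (∀ z ∈ Metric.ball (0 : ℂ) ρ, F z = ∑ s ∈ Finset.range S, a s * z ^ s + z ^ S * G z) →
      (∀ z ∈ Metric.ball (0 : ℂ) ρ, ‖G z‖ ≤ L) → (∀ s < S, ‖a s‖ ≤ L) →
      ‖(∫ t in (0 : ℝ)..1, Complex.exp (-N * (t * w) ^ μ) * F (t * w) * w) -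
        ∑ s ∈ Finset.range S, a s * (1 / μ) * (Real.Gamma (((s : ℝ) + 1) / μ) : ℂ) *
          Complex.exp (((s : ℂ) + 1) * (β * Complex.I)) /
            ((N ^ (((s : ℝ) + 1) / μ) : ℝ) : ℂ)‖ ≤
        C * (L / N ^ (((S : ℝ) + 1) / μ)) := by
  obtain ⟨C, hC⟩ := exists_norm_segment_integral_sub_le hμ S hwρ hre
  refine ⟨C, fun F G a L N hN hF he hG ha => ?_⟩
  have h := hC F G a L N hN hF he hG ha
  convert h using 5 with s _
  have := pow_mul_cpow_of_direction hμ hr hw hβ hδ hre hN s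
  rw [mul_div_assoc, ← this]
  ring

theorem cpow_natCast_inv_eq {x : ℂ} (hx : x ≠ 0) (μ : ℕ) :
    x ^ ((μ : ℂ)⁻¹) = ((‖x‖ ^ ((μ : ℝ)⁻¹) : ℝ) : ℂ) *
      Complex.exp ((Complex.arg x / μ : ℝ) * Complex.I) := by
  rw [Complex.cpow_def_of_ne_zero hx, Real.rpow_def_of_pos (norm_pos_iff.2 hx),
    Complex.ofReal_exp, ← Complex.exp_add]
  congr 1
  rw [Complex.log]
  push_cast
  ring

/-- In the local coordinate `(z - z₀) p₀ ^ (1 / μ) u ^ (1 / μ)`, with `Re u > 0`, points of the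
sector of width `2 π / μ` about the angle `β'` have direction within `3 π / (2 μ)` of
`β' + arg p₀ / μ`. -/
theorem exists_direction_of_mem_sector {μ : ℕ} (hμ : μ ≠ 0) {z z₀ p₀ u : ℂ} {β' : ℝ}
    (hz : z ∈ sector z₀ β' (2 * Real.pi / μ)) (hne : z ≠ z₀) (hp₀ : p₀ ≠ 0) (hu : 0 < u.re) :
    ∃ r δ : ℝ, 0 < r ∧ |μ * δ| < 3 * Real.pi / 2 ∧
      (z - z₀) * (p₀ ^ ((μ : ℂ)⁻¹) * u ^ ((μ : ℂ)⁻¹)) =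
        r * Complex.exp ((β' + Complex.arg p₀ / μ + δ : ℝ) * Complex.I) := by
  obtain ⟨r, θ, hr, hθ, rfl⟩ := hz
  have hμ0 : (0 : ℝ) < μ := by positivity
  have hr0 : 0 < r := by
    refine hr.lt_of_ne fun h => hne ?_
    rw [← h]
    simp
  have hu0 : u ≠ 0 := fun h => by simp [h] at hu
  have hargu : |Complex.arg u| < Real.pi / 2 := Complex.abs_arg_lt_pi_div_two_iff.2 (Or.inl hu)
  -- After multiplication by `μ`, the deviation is at most `π` from the sector plus less than `π/2`
  -- from `arg u`.
  refine ⟨r * ‖p₀‖ ^ ((μ : ℝ)⁻¹) * ‖u‖ ^ ((μ : ℝ)⁻¹), θ - β' + Complex.arg u / μ, ?_, ?_, ?_⟩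
  · have := norm_pos_iff.2 hu0
    have := norm_pos_iff.2 hp₀
    positivity
  · have h1 : μ * (θ - β' + Complex.arg u / μ) = μ * (θ - β') + Complex.arg u := by
      field_simp
    have h2 : |μ * (θ - β')| ≤ Real.pi := by
      rw [abs_mul, abs_of_pos hμ0]
      calc μ * |θ - β'| ≤ μ * (2 * Real.pi / μ / 2) := by gcongr
        _ = Real.pi := by field_simp
    rw [h1]
    have := abs_add_le (μ * (θ - β')) (Complex.arg u)
    linarith
  · rw [cpow_natCast_inv_eq hp₀, cpow_natCast_inv_eq hu0, show (β' + Complex.arg p₀ / μ +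
      (θ - β' + Complex.arg u / μ) : ℝ) = θ + Complex.arg p₀ / μ + Complex.arg u / μ by ring]
    push_cast
    rw [add_mul, add_mul, Complex.exp_add, Complex.exp_add]
    ring

/-! ### Integrals along contours -/

theorem IsContour.intervalIntegrable {c f : ℝ → ℂ} (hc : IsContour c)
    (hf : ContinuousOn f (Icc 0 1)) :
    IntervalIntegrable (fun t => f t * deriv c t) MeasureTheory.volume 0 1 :=
  hc.finite_length.continuousOn_mul (by rwa [uIcc_of_le zero_le_one])

/-- The fundamental theorem of calculus with a finite exceptional set: path independence takes the
place of an explicit contour deformation. -/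
theorem IsContour.integral_eq_sub {c : ℝ → ℂ} (hc : IsContour c) {f Ψ : ℂ → ℂ} {U : Set ℂ}
    {a b : ℝ} (ha : 0 ≤ a) (hab : a ≤ b) (hb : b ≤ 1) (hU : MapsTo c (Icc a b) U)
    (hΨ : ∀ z ∈ U, HasDerivAt Ψ (f z) z)
    (hint : IntervalIntegrable (fun t => f (c t) * deriv c t) MeasureTheory.volume a b) :
    ∫ t in a..b, f (c t) * deriv c t = Ψ (c b) - Ψ (c a) := by
  obtain ⟨F, hF, hFd⟩ := hc.continuous_deriv
  refine MeasureTheory.integral_eq_of_hasDerivAt_off_countable_of_le (fun t => Ψ (c t)) _ hab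
    hF.countable ?_ ?_ hint
  · intro t ht
    exact (hΨ _ (hU ht)).continuousAt.comp_continuousWithinAt
      ((hc.continuousOn.mono (Icc_subset_Icc ha hb)) t ht)
  · rintro t ⟨ht, htF⟩
    have h1 := (hFd t ⟨⟨ha.trans_lt ht.1, ht.2.trans_le hb⟩, htF⟩).1.hasDerivAt
    exact (hΨ _ (hU (Ioo_subset_Icc_self ht))).comp_of_eq t h1 rfl

theorem norm_integral_le_of_re_le {c : ℝ → ℂ} {p q : ℂ → ℂ} {a b m K N : ℝ} (hab : a ≤ b)
    (hN : 0 ≤ N) (hint : IntervalIntegrable (deriv c) MeasureTheory.volume a b)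
    (hp : ∀ t ∈ Icc a b, (p (c t)).re ≤ m) (hq : ∀ t ∈ Icc a b, ‖q (c t)‖ ≤ K) :
    ‖∫ t in a..b, Complex.exp (N * p (c t)) * q (c t) * deriv c t‖ ≤
      Real.exp (N * m) * K * ∫ t in a..b, ‖deriv c t‖ := by
  rw [← intervalIntegral.integral_const_mul]
  refine intervalIntegral.norm_integral_le_of_norm_le hab (Eventually.of_forall fun t ht => ?_)
    (hint.norm.const_mul _)
  have ht' := Ioc_subset_Icc_self ht
  rw [norm_mul, norm_mul, Complex.norm_exp, Complex.re_ofReal_mul]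
  have h1 := hp t ht'
  have h2 := hq t ht'
  gcongr

theorem exists_re_le_sub {c : ℝ → ℂ} {p : ℂ → ℂ} {a b v : ℝ} (hab : a ≤ b)
    (hc : ContinuousOn (fun t => p (c t)) (Icc a b)) (hlt : ∀ t ∈ Icc a b, (p (c t)).re < v) :
    ∃ ε > 0, ∀ t ∈ Icc a b, (p (c t)).re ≤ v - ε := by
  obtain ⟨t₁, ht₁, hmax⟩ := isCompact_Icc.exists_isMaxOn (nonempty_Icc.2 hab)
    (Complex.continuous_re.comp_continuousOn hc)
  refine ⟨v - (p (c t₁)).re, sub_pos.2 (hlt t₁ ht₁), fun t ht => ?_⟩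
  have : (p (c t)).re ≤ (p (c t₁)).re := hmax ht
  linarith

/-- The primitive `Ψ` is differentiated along `t ↦ g (t * w)`, where the exponent is exactly `N * (p
z₀ - (t * w) ^ μ)`. -/
theorem sub_eq_segment_integral {z₀ : ℂ} {R ρ N : ℝ} {μ : ℕ} {g p q Ψ : ℂ → ℂ}
    (hg : DifferentiableOn ℂ g (Metric.ball 0 ρ))
    (hgR : MapsTo g (Metric.ball 0 ρ) (Metric.ball z₀ R)) (hg0 : g 0 = z₀)
    (hpg : ∀ w ∈ Metric.ball (0 : ℂ) ρ, p (g w) = p z₀ - w ^ μ)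
    (hq : ContinuousOn q (Metric.ball z₀ R))
    (hΨ : ∀ z ∈ Metric.ball z₀ R, HasDerivAt Ψ (Complex.exp (N * p z) * q z) z)
    {w : ℂ} (hw : ‖w‖ < ρ) :
    Ψ (g w) - Ψ z₀ = Complex.exp (N * p z₀) *
      ∫ t in (0 : ℝ)..1, Complex.exp (-N * (t * w) ^ μ) *
        (q (g (t * w)) * deriv g (t * w)) * w := by
  have hmem : ∀ t ∈ Icc (0 : ℝ) 1, (t : ℂ) * w ∈ Metric.ball (0 : ℂ) ρ := by
    intro t ht
    rw [mem_ball_zero_iff, norm_mul, Complex.norm_real, Real.norm_of_nonneg ht.1]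
    exact (mul_le_of_le_one_left (norm_nonneg w) ht.2).trans_lt hw
  have hseg : ContinuousOn (fun t : ℝ => (t : ℂ) * w) (Icc 0 1) := by fun_prop
  rw [← intervalIntegral.integral_const_mul]
  have hu : uIcc (0 : ℝ) 1 = Icc 0 1 := uIcc_of_le zero_le_one
  rw [intervalIntegral.integral_eq_sub_of_hasDerivAt (f := fun t : ℝ => Ψ (g (t * w)))]
  · simp [hg0]
  · intro t ht
    rw [hu] at ht
    have h0 := hmem t ht
    have h1 : HasDerivAt (fun t : ℝ => (t : ℂ) * w) w t := by
      simpa using (Complex.ofRealCLM.hasDerivAt (x := t)).mul_const w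
    have h2 := (hg.differentiableAt (Metric.isOpen_ball.mem_nhds h0)).hasDerivAt
    have h3 := (hΨ _ (hgR h0)).comp _ h2
    have h4 := HasDerivAt.comp_of_eq t h3 h1 rfl
    refine h4.congr_deriv ?_
    rw [hpg _ h0, mul_sub, sub_eq_add_neg, Complex.exp_add, neg_mul]
    ring
  · refine ContinuousOn.intervalIntegrable ?_
    rw [hu]
    have h1 : ContinuousOn (fun t : ℝ => q (g (t * w))) (Icc 0 1) :=
      (hq.comp hg.continuousOn hgR).comp hseg hmem
    have h2 : ContinuousOn (fun t : ℝ => deriv g (t * w)) (Icc 0 1) :=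
      (hg.deriv Metric.isOpen_ball).continuousOn.comp hseg hmem
    exact continuousOn_const.mul
      (((Continuous.continuousOn (by fun_prop)).mul (h1.mul h2)).mul continuousOn_const)

theorem sum_range_two_mul {A : Type*} [AddCommMonoid A] (f : ℕ → A) (M : ℕ) :
    ∑ s ∈ Finset.range (2 * M), f s = ∑ m ∈ Finset.range M, (f (2 * m) + f (2 * m + 1)) := by
  induction M with
  | zero => simp
  | succ M ih =>
    rw [Nat.mul_succ, Finset.sum_range_succ, Finset.sum_range_succ, ih, Finset.sum_range_succ,
      add_assoc]

/-! ### Perron's method -/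

/-- Every power is an integer power of a principal `μ`-th root, so no branch question arises in
combining `p₀` and `1 - φ`. The last factor `1 / μ` is the one from the Laplace integral. -/
theorem coeff_eq (μ : ℕ) (p₀ : ℂ) (φ q : ℂ → ℂ) (z₀ : ℂ) (s : ℕ) :
    coeff μ p₀ φ q z₀ s = (s.factorial : ℂ)⁻¹ * iteratedDeriv s (fun z =>
      q z / (p₀ ^ ((μ : ℂ)⁻¹) * (1 - φ z) ^ ((μ : ℂ)⁻¹)) ^ (s + 1)) z₀ * (1 / μ) := by
  have hpow : ∀ x : ℂ, x ^ (-((s : ℂ) + 1) / μ) = ((x ^ ((μ : ℂ)⁻¹)) ^ (s + 1))⁻¹ := by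
    intro x
    rw [← Complex.cpow_nat_mul, ← Complex.cpow_neg]
    congr 1
    push_cast
    ring
  have hfun : (fun z => q z / (p₀ ^ ((μ : ℂ)⁻¹) * (1 - φ z) ^ ((μ : ℂ)⁻¹)) ^ (s + 1)) =
      fun z => p₀ ^ (-((s : ℂ) + 1) / μ) * (q z * (1 - φ z) ^ (-((s : ℂ) + 1) / μ)) := by
    funext z
    rw [hpow, hpow, mul_pow, div_eq_mul_inv, mul_inv]
    ring
  rw [hfun, iteratedDeriv_const_mul_field, coeff, one_div, mul_inv]
  ring

/-- An odd number of half turns contributes the sign `(-1) ^ (s + 1)`; it causes the cancellation of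
the odd-index terms. -/
theorem exp_opposite (s : ℕ) (β : ℝ) (n : ℤ) :
    Complex.exp (((s : ℂ) + 1) * ((β + (2 * n + 1) * Real.pi : ℝ) * Complex.I)) =
      Complex.exp (((s : ℂ) + 1) * (β * Complex.I)) * (-1) ^ (s + 1) := by
  have h : Complex.exp ((2 * (n : ℂ) + 1) * Real.pi * Complex.I) = -1 := by
    rw [show (2 * (n : ℂ) + 1) * Real.pi * Complex.I =
      n * (2 * Real.pi * Complex.I) + Real.pi * Complex.I by ring, Complex.exp_add,
      Complex.exp_int_mul_two_pi_mul_I, Complex.exp_pi_mul_I, one_mul]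
  rw [← h, ← Complex.exp_nat_mul, ← Complex.exp_add]
  congr 1
  push_cast
  ring

theorem exists_forall_exp_neg_le {ε : ℝ} (hε : 0 < ε) (κ : ℝ) :
    ∃ N₀ : ℝ, ∀ N : ℝ, 0 < N → N₀ ≤ N → Real.exp (-ε * N) ≤ 1 / N ^ κ := by
  have h := (tendsto_rpow_mul_exp_neg_mul_atTop_nhds_zero κ ε hε).eventually_le_const one_pos
  obtain ⟨N₀, hN₀⟩ := eventually_atTop.1 h
  refine ⟨N₀, fun N hN hN' => ?_⟩
  rw [le_div_iff₀ (Real.rpow_pos_of_pos hN κ), mul_comm]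
  exact hN₀ N hN'

/-- Times just before and just after `t₀` can be chosen such that `c` stays near `c t₀` between
them. -/
theorem exists_times {c : ℝ → ℂ} {t₀ : ℝ} (ht₀ : t₀ ∈ Ioo (0 : ℝ) 1)
    (hc : ContinuousOn c (Icc 0 1)) {W : Set ℂ} (hW : W ∈ 𝓝 (c t₀)) {P Q : ℝ → Prop}
    (hP : ∀ᶠ t in 𝓝[<] t₀, P t) (hQ : ∀ᶠ t in 𝓝[>] t₀, Q t) :
    ∃ t₁ t₂ : ℝ, 0 < t₁ ∧ t₁ < t₀ ∧ t₀ < t₂ ∧ t₂ < 1 ∧ P t₁ ∧ Q t₂ ∧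
      ∀ t ∈ Icc t₁ t₂, c t ∈ W := by
  have hct : ContinuousAt c t₀ := hc.continuousAt (Icc_mem_nhds ht₀.1 ht₀.2)
  obtain ⟨η, hη, hball⟩ := Metric.eventually_nhds_iff_ball.1 (hct.eventually hW)
  obtain ⟨t₁, hP₁, h1, h1'⟩ := (hP.and (Eventually.and
    (Ioo_mem_nhdsLT (sub_lt_self t₀ hη)) (Ioo_mem_nhdsLT ht₀.1))).exists
  obtain ⟨t₂, hQ₂, h2, h2'⟩ := (hQ.and (Eventually.and
    (Ioo_mem_nhdsGT (lt_add_of_pos_right t₀ hη)) (Ioo_mem_nhdsGT ht₀.2))).exists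
  refine ⟨t₁, t₂, h1'.1, h1.2, h2.1, h2'.2, hP₁, hQ₂, fun t ht => hball t ?_⟩
  rw [Real.ball_eq_Ioo]
  exact ⟨h1.1.trans_le ht.1, ht.2.trans_lt h2.2⟩

end Perron

theorem corollary5p1
    -- the contour, the point and the neighborhood
    (c : ℝ → ℂ) (hc : Perron.IsContour c)
    (z₀ : ℂ) (B : Set ℂ) (hB : B ∈ 𝓝 z₀)
    -- `p` is holomorphic on a domain containing the neighborhood and the contour
    (U : Set ℂ) (hU : Perron.IsPlaneDomain U) (hBU : B ∪ Perron.trace c ⊆ U)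
    (p : ℂ → ℂ) (hp : DifferentiableOn ℂ p U)
    -- the local form of `p` at `z₀`
    (μ : ℕ) (hμ : 1 ≤ μ) (hμ_even : Even μ)
    (p₀ : ℂ) (hp₀ : p₀ ≠ 0)
    (φ : ℂ → ℂ) (hφ : DifferentiableOn ℂ φ B) (hφ₀ : φ z₀ = 0)
    (hpφ : ∀ z ∈ B, p z = p z₀ - p₀ * (z - z₀) ^ μ * (1 - φ z))
    -- the contour starts at `c 0`, passes through `z₀` (once, at time `t₀`) and ends at `c 1`
    (hne₁ : c 0 ≠ z₀) (hne₂ : c 1 ≠ z₀) (hne₃ : c 0 ≠ c 1)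
    (t₀ : ℝ) (ht₀ : t₀ ∈ Icc (0 : ℝ) 1) (hct₀ : c t₀ = z₀)
    (honce : ∀ t ∈ Icc (0 : ℝ) 1, c t = z₀ → t = t₀)
    (hmax : ∀ z ∈ Perron.trace c, z ≠ z₀ → (p z).re < (p z₀).re)
    -- the sectors in which the contour approaches and leaves `z₀`
    (k n : ℤ)
    (happroach : ∀ᶠ t in 𝓝[<] t₀, c t ∈
      Perron.sector z₀ (Perron.steepestAngle μ p₀ k + (2 * n + 1) * Real.pi) (2 * Real.pi / μ))
    (hleave : ∀ᶠ t in 𝓝[>] t₀, c t ∈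
      Perron.sector z₀ (Perron.steepestAngle μ p₀ k) (2 * Real.pi / μ))
    (M : ℕ) :
    -- the implied constant and the range of `N` do not depend on `q`
    ∃ C N₀ : ℝ, ∀ (V : Set ℂ) (q : ℂ → ℂ) (K : ℝ),
      Perron.IsPlaneDomain V → B ∪ Perron.trace c ⊆ V → DifferentiableOn ℂ q V →
      (∀ z ∈ B ∪ Perron.trace c, ‖q z‖ ≤ K) →
      ∀ N : ℝ, 0 < N → N₀ ≤ N →
        ∃ E : ℂ, ‖E‖ ≤ C * (K / N ^ ((2 * (M : ℝ) + 1) / μ)) ∧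
          Perron.contourIntegral c (fun z => Complex.exp (N * p z) * q z) =
            Complex.exp (N * p z₀) *
              (∑ m ∈ Finset.range M,
                (Real.Gamma ((2 * (m : ℝ) + 1) / μ) : ℂ) *
                  (2 * Perron.coeff μ p₀ φ q z₀ (2 * m) *
                    Complex.exp (2 * Real.pi * Complex.I * k * (2 * m + 1) / μ)) /
                  ((N ^ ((2 * (m : ℝ) + 1) / μ) : ℝ) : ℂ) + E) := by
  have hμ0 : μ ≠ 0 := by omega
  have hμC : (μ : ℂ) ≠ 0 := by exact_mod_cast hμ0
  -- the local coordinate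
  have hφc : ContinuousAt φ z₀ := (hφ.differentiableAt hB).continuousAt
  have hev : ∀ᶠ z in 𝓝 z₀, 0 < (1 - φ z).re := by
    have h1 : ContinuousAt (fun z => (1 - φ z).re) z₀ :=
      Complex.continuous_re.continuousAt.comp (continuousAt_const.sub hφc)
    refine h1.eventually_const_lt ?_
    simp [hφ₀]
  obtain ⟨R, hR, hball⟩ := Metric.eventually_nhds_iff_ball.1 (hev.and hB)
  have hRB : Metric.ball z₀ R ⊆ B := fun z hz => (hball z hz).2
  set κ : ℂ → ℂ := fun z => p₀ ^ ((μ : ℂ)⁻¹) * (1 - φ z) ^ ((μ : ℂ)⁻¹) with hκdef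
  have hκd : DifferentiableOn ℂ κ (Metric.ball z₀ R) :=
    (((hφ.mono hRB).const_sub 1).cpow_const fun z hz => Or.inl (hball z hz).1).const_mul _
  have hκ0 : ∀ z ∈ Metric.ball z₀ R, κ z ≠ 0 := by
    intro z hz
    have h1 : (1 - φ z) ≠ 0 := fun h => by
      have := (hball z hz).1
      simp [h] at this
    exact mul_ne_zero (by simp [Complex.cpow_eq_zero_iff, hp₀])
      (by simp [Complex.cpow_eq_zero_iff, h1])
  have hpκ : ∀ z ∈ Metric.ball z₀ R, p z = p z₀ - ((z - z₀) * κ z) ^ μ := by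
    intro z hz
    rw [hpφ z (hRB hz), hκdef, mul_pow, mul_pow, Complex.cpow_nat_inv_pow _ hμ0,
      Complex.cpow_nat_inv_pow _ hμ0]
    ring
  obtain ⟨ρ, hρ, g, D, hg, hgR, hg0, hgκ, hgD, hgl⟩ :=
    Perron.exists_local_inverse hR hκd (hκ0 z₀ (Metric.mem_ball_self hR))
  have hpg : ∀ w ∈ Metric.ball (0 : ℂ) ρ, p (g w) = p z₀ - w ^ μ := fun w hw => by
    rw [hpκ _ (hgR hw), hgκ w hw]
  -- times close to `t₀`
  have ht₀' : t₀ ∈ Ioo (0 : ℝ) 1 :=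
    ⟨ht₀.1.lt_of_ne fun h => hne₁ (h ▸ hct₀), ht₀.2.lt_of_ne fun h => hne₂ (h ▸ hct₀)⟩
  have hsmall : ∀ᶠ z in 𝓝 z₀, ‖(z - z₀) * κ z‖ < ρ := by
    have h1 : ContinuousAt (fun z => ‖(z - z₀) * κ z‖) z₀ :=
      ((continuousAt_id.sub continuousAt_const).mul
        (hκd.differentiableAt (Metric.ball_mem_nhds z₀ hR)).continuousAt).norm
    refine h1.eventually_lt_const ?_
    simpa using hρ
  -- The last condition makes the cut points `c t₁` and `c t₂` images under `g` of their local
  -- coordinates.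
  have hW : {z | (z ∈ Metric.ball z₀ R ∧ ‖(z - z₀) * κ z‖ < ρ) ∧ g ((z - z₀) * κ z) = z} ∈
      𝓝 (c t₀) := by
    rw [hct₀]
    exact (Eventually.and (Metric.ball_mem_nhds z₀ hR) hsmall).and hgl
  obtain ⟨t₁, t₂, h0t₁, ht₁, ht₂, ht₂1, hs₁, hs₂, hmid⟩ :=
    Perron.exists_times ht₀' hc.continuousOn hW happroach hleave
  have ht₁₂ : t₁ ≤ t₂ := (ht₁.trans ht₂).le
  have hcne : ∀ t ∈ Icc (0 : ℝ) 1, t ≠ t₀ → c t ≠ z₀ := fun t ht h h' => h (honce t ht h')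
  have hclt : ∀ t ∈ Icc (0 : ℝ) 1, t ≠ t₀ → (p (c t)).re < (p z₀).re := fun t ht h =>
    hmax _ (mem_image_of_mem c ht) (hcne t ht h)
  have hpc : ContinuousOn (fun t => p (c t)) (Icc 0 1) :=
    hp.continuousOn.comp hc.continuousOn fun t ht => hBU (Or.inr (mem_image_of_mem c ht))
  have hI₁ : Icc 0 t₁ ⊆ Icc (0 : ℝ) 1 := Icc_subset_Icc le_rfl (by linarith)
  have hI₃ : Icc t₂ 1 ⊆ Icc (0 : ℝ) 1 := Icc_subset_Icc (by linarith [ht₀'.1]) le_rfl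
  have hI₂ : Icc t₁ t₂ ⊆ Icc (0 : ℝ) 1 := Icc_subset_Icc h0t₁.le ht₂1.le
  obtain ⟨ε₁, hε₁, hp₁⟩ := Perron.exists_re_le_sub h0t₁.le (hpc.mono hI₁)
    fun t ht => hclt t (hI₁ ht) (ht.2.trans_lt ht₁).ne
  obtain ⟨ε₃, hε₃, hp₃⟩ := Perron.exists_re_le_sub ht₂1.le (hpc.mono hI₃)
    fun t ht => hclt t (hI₃ ht) (ht₂.trans_le ht.1).ne'
  -- the ends of the middle part in the local coordinate
  set w₁ : ℂ := (c t₁ - z₀) * κ (c t₁) with hw₁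
  set w₂ : ℂ := (c t₂ - z₀) * κ (c t₂) with hw₂
  obtain ⟨⟨hb₁, hn₁⟩, hgw₁⟩ := hmid t₁ (left_mem_Icc.2 ht₁₂)
  obtain ⟨⟨hb₂, hn₂⟩, hgw₂⟩ := hmid t₂ (right_mem_Icc.2 ht₁₂)
  have hre₁ : 0 < (w₁ ^ μ).re := by
    have h1 := hclt t₁ (hI₂ (left_mem_Icc.2 ht₁₂)) ht₁.ne
    rw [hpκ _ hb₁, Complex.sub_re] at h1
    linarith
  have hre₂ : 0 < (w₂ ^ μ).re := by
    have h1 := hclt t₂ (hI₂ (right_mem_Icc.2 ht₁₂)) ht₂.ne'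
    rw [hpκ _ hb₂, Complex.sub_re] at h1
    linarith
  set β : ℝ := 2 * Real.pi * k / μ with hβdef
  obtain ⟨r₁, δ₁, hr₁, hδ₁, hdir₁⟩ := Perron.exists_direction_of_mem_sector hμ0 hs₁
    (hcne t₁ (hI₂ (left_mem_Icc.2 ht₁₂)) ht₁.ne) hp₀ (hball _ hb₁).1
  obtain ⟨r₂, δ₂, hr₂, hδ₂, hdir₂⟩ := Perron.exists_direction_of_mem_sector hμ0 hs₂
    (hcne t₂ (hI₂ (right_mem_Icc.2 ht₁₂)) ht₂.ne') hp₀ (hball _ hb₂).1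
  have hang₂ : Perron.steepestAngle μ p₀ k + Complex.arg p₀ / μ = β := by
    rw [Perron.steepestAngle, hβdef]
    ring
  have hang₁ : Perron.steepestAngle μ p₀ k + (2 * n + 1) * Real.pi + Complex.arg p₀ / μ =
      β + (2 * n + 1) * Real.pi := by
    rw [← hang₂]
    ring
  rw [hang₁] at hdir₁
  rw [hang₂] at hdir₂
  have hβ₂ : Complex.exp (μ * (β * Complex.I)) = 1 := by
    rw [← Complex.exp_int_mul_two_pi_mul_I k]
    congr 1
    rw [hβdef]
    push_cast
    field_simp
  -- Evenness of `μ` enters here: the opposite direction is again one in which `w ^ μ` is positive.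
  have hβ₁ : Complex.exp (μ * ((β + (2 * n + 1) * Real.pi : ℝ) * Complex.I)) = 1 := by
    have h1 := Perron.exp_opposite (μ - 1) β n
    have h2 : ((μ - 1 : ℕ) : ℂ) + 1 = μ := by
      rw [← Nat.cast_succ, Nat.succ_eq_add_one, Nat.sub_add_cancel hμ]
    rw [h2, hβ₂, Nat.sub_add_cancel hμ, hμ_even.neg_one_pow, one_mul] at h1
    exact h1
  -- Taking `2 * M` Taylor terms leaves `M` terms after cancellation and an error of order `(2M + 1)
  -- / μ`.
  obtain ⟨C₁, hC₁⟩ := Perron.exists_norm_segment_integral_sub_le_of_direction hμ0 (2 * M) hn₁ hre₁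
    hr₁ hdir₁ hβ₁ hδ₁
  obtain ⟨C₂, hC₂⟩ := Perron.exists_norm_segment_integral_sub_le_of_direction hμ0 (2 * M) hn₂ hre₂
    hr₂ hdir₂ hβ₂ hδ₂
  obtain ⟨N₁, hN₁⟩ := Perron.exists_forall_exp_neg_le hε₁ ((2 * (M : ℝ) + 1) / μ)
  obtain ⟨N₃, hN₃⟩ := Perron.exists_forall_exp_neg_le hε₃ ((2 * (M : ℝ) + 1) / μ)
  set X : ℝ := ∑ s ∈ Finset.range (2 * M + 1), (2 / ρ) ^ s with hX
  set l₁ : ℝ := ∫ t in (0 : ℝ)..t₁, ‖deriv c t‖ with hl₁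
  set l₃ : ℝ := ∫ t in t₂..(1 : ℝ), ‖deriv c t‖ with hl₃
  -- `l₁ + l₃` pays for the outer parts and `(C₁ + C₂) * (X * D)` for the two segments, `X * (K *
  -- D)` being a common bound for the Taylor data; everything is fixed before `q`.
  refine ⟨l₁ + l₃ + (C₁ + C₂) * (X * D), max N₁ N₃, ?_⟩
  intro V q K hV hBV hq hqK N hN hNN
  have hK : 0 ≤ K := (norm_nonneg _).trans (hqK z₀ (Or.inl (mem_of_mem_nhds hB)))
  have hqR : DifferentiableOn ℂ q (Metric.ball z₀ R) :=
    hq.mono fun z hz => hBV (Or.inl (hRB hz))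
  have hD : 0 ≤ D := (norm_nonneg _).trans (hgD 0 (Metric.mem_ball_self hρ))
  -- the integrand in the local coordinate and its Taylor expansion
  set F : ℂ → ℂ := fun w => q (g w) * deriv g w with hF
  have hFd : DifferentiableOn ℂ F (Metric.ball 0 ρ) :=
    (hqR.comp hg hgR).mul (hg.deriv Metric.isOpen_ball)
  obtain ⟨a, G, hG, hFe, hbd⟩ := Perron.exists_taylor_decomposition hρ (2 * M) F hFd
  simp only [sub_zero] at hFe
  obtain ⟨hGb, hab⟩ := hbd (K * D) fun w hw => by
    rw [hF, norm_mul]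
    exact mul_le_mul (hqK _ (Or.inl (hRB (hgR hw)))) (hgD w hw) (norm_nonneg _) hK
  have hXle : ∀ s ∈ Finset.range (2 * M + 1), (2 / ρ) ^ s * (K * D) ≤ X * (K * D) := by
    intro s hs
    refine mul_le_mul_of_nonneg_right ?_ (by positivity)
    exact Finset.single_le_sum (f := fun s => (2 / ρ) ^ s) (fun i _ => by positivity) hs
  have hGb' : ∀ z ∈ Metric.ball (0 : ℂ) ρ, ‖G z‖ ≤ X * (K * D) := fun z hz =>
    (hGb z hz).trans (hXle _ (by simp))
  have hab' : ∀ s < 2 * M, ‖a s‖ ≤ X * (K * D) := fun s hs =>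
    (hab s hs).trans (hXle s (Finset.mem_range.2 (by omega)))
  have hcoeff : ∀ s < 2 * M, a s * (1 / μ) = Perron.coeff μ p₀ φ q z₀ s := by
    intro s hs
    rw [Perron.coeff_eq,
      Perron.taylor_coeff_comp_inverse hR hρ hg hgR hκd hκ0 hqR hgκ hG hFe hs]
  have hW₁ := hC₁ F G a _ N hN hFd.continuousOn hFe hGb' hab'
  have hW₂ := hC₂ F G a _ N hN hFd.continuousOn hFe hGb' hab'
  set J₁ : ℂ := ∫ t in (0 : ℝ)..1, Complex.exp (-N * (t * w₁) ^ μ) * F (t * w₁) * w₁ with hJ₁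
  set J₂ : ℂ := ∫ t in (0 : ℝ)..1, Complex.exp (-N * (t * w₂) ^ μ) * F (t * w₂) * w₂ with hJ₂
  set T₁ : ℂ := ∑ s ∈ Finset.range (2 * M), a s * (1 / μ) *
    (Real.Gamma (((s : ℝ) + 1) / μ) : ℂ) *
    Complex.exp (((s : ℂ) + 1) * ((β + (2 * n + 1) * Real.pi : ℝ) * Complex.I)) /
    ((N ^ (((s : ℝ) + 1) / μ) : ℝ) : ℂ) with hT₁
  set T₂ : ℂ := ∑ s ∈ Finset.range (2 * M), a s * (1 / μ) *
    (Real.Gamma (((s : ℝ) + 1) / μ) : ℂ) * Complex.exp (((s : ℂ) + 1) * (β * Complex.I)) /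
    ((N ^ (((s : ℝ) + 1) / μ) : ℝ) : ℂ) with hT₂
  have hmain : T₂ - T₁ = ∑ m ∈ Finset.range M,
      (Real.Gamma ((2 * (m : ℝ) + 1) / μ) : ℂ) * (2 * Perron.coeff μ p₀ φ q z₀ (2 * m) *
        Complex.exp (2 * Real.pi * Complex.I * k * (2 * m + 1) / μ)) /
        ((N ^ ((2 * (m : ℝ) + 1) / μ) : ℝ) : ℂ) := by
    rw [hT₁, hT₂, ← Finset.sum_sub_distrib, Perron.sum_range_two_mul]
    refine Finset.sum_congr rfl fun m hm => ?_
    have hm' := Finset.mem_range.1 hm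
    rw [Perron.exp_opposite, Perron.exp_opposite, hcoeff _ (by omega : 2 * m < 2 * M),
      Odd.neg_one_pow ⟨m, rfl⟩, Even.neg_one_pow ⟨m + 1, by ring⟩]
    have h1 : (((2 * m : ℕ) : ℂ) + 1) * (β * Complex.I) =
        2 * Real.pi * Complex.I * k * (2 * m + 1) / μ := by
      rw [hβdef]
      push_cast
      ring
    have h2 : ((2 * m : ℕ) : ℝ) = 2 * (m : ℝ) := by push_cast; ring
    rw [h1, h2]
    ring
  -- the three parts of the contour
  have hqc : ContinuousOn (fun t => q (c t)) (Icc 0 1) :=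
    hq.continuousOn.comp hc.continuousOn fun t ht => hBV (Or.inr (mem_image_of_mem c ht))
  have hint := hc.intervalIntegrable (f := fun t => Complex.exp (N * p (c t)) * q (c t))
    ((continuousOn_const.mul hpc).cexp.mul hqc)
  have hu : ∀ {x y : ℝ}, x ≤ y → Icc x y ⊆ Icc (0 : ℝ) 1 → uIcc x y ⊆ uIcc (0 : ℝ) 1 :=
    fun hxy h => by rwa [uIcc_of_le hxy, uIcc_of_le zero_le_one]
  have hint₁ := hint.mono_set (hu h0t₁.le hI₁)
  have hint₂ := hint.mono_set (hu ht₁₂ hI₂)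
  have hint₃ := hint.mono_set (hu ht₂1.le hI₃)
  have hsplit := intervalIntegral.integral_add_adjacent_intervals
    (hint₁.trans hint₂) hint₃
  rw [← intervalIntegral.integral_add_adjacent_intervals hint₁ hint₂] at hsplit
  set I₁ : ℂ := ∫ t in (0 : ℝ)..t₁, Complex.exp (N * p (c t)) * q (c t) * deriv c t with hI₁'
  set I₃ : ℂ := ∫ t in t₂..(1 : ℝ), Complex.exp (N * p (c t)) * q (c t) * deriv c t with hI₃'
  have hfd : DifferentiableOn ℂ (fun z => Complex.exp (N * p z) * q z) (Metric.ball z₀ R) :=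
    ((hp.mono fun z hz => hBU (Or.inl (hRB hz))).const_mul (N : ℂ)).cexp.mul hqR
  -- A holomorphic function on a disc has a primitive; only this disc is used, so the global domains
  -- need not be simply connected.
  obtain ⟨Ψ, hΨ⟩ := hfd.isConservativeOn.isExactOn_ball hfd.continuousOn
  have hI₂' := hc.integral_eq_sub h0t₁.le ht₁₂ ht₂1.le
    (fun t ht => (hmid t ht).1.1) hΨ hint₂
  have hseg₁ := Perron.sub_eq_segment_integral hg hgR hg0 hpg hqR.continuousOn hΨ hn₁
  have hseg₂ := Perron.sub_eq_segment_integral hg hgR hg0 hpg hqR.continuousOn hΨ hn₂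
  rw [hgw₁] at hseg₁
  rw [hgw₂] at hseg₂
  have hb₁' := Perron.norm_integral_le_of_re_le h0t₁.le hN.le
    (hc.finite_length.mono_set (hu h0t₁.le hI₁)) hp₁
    (fun t ht => hqK _ (Or.inr (mem_image_of_mem c (hI₁ ht))))
  have hb₃' := Perron.norm_integral_le_of_re_le ht₂1.le hN.le
    (hc.finite_length.mono_set (hu ht₂1.le hI₃)) hp₃
    (fun t ht => hqK _ (Or.inr (mem_image_of_mem c (hI₃ ht))))
  have hexp : ∀ ε : ℝ, ‖Complex.exp (-(N * p z₀))‖ * Real.exp (N * ((p z₀).re - ε)) =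
      Real.exp (-ε * N) := by
    intro ε
    rw [Complex.norm_exp, Complex.neg_re, Complex.re_ofReal_mul, ← Real.exp_add]
    congr 1
    ring
  set P : ℝ := N ^ ((2 * (M : ℝ) + 1) / μ) with hP
  have hP0 : 0 < P := Real.rpow_pos_of_pos hN _
  have houter : ∀ (I : ℂ) (ε l : ℝ), 0 ≤ l → Real.exp (-ε * N) ≤ 1 / P →
      ‖I‖ ≤ Real.exp (N * ((p z₀).re - ε)) * K * l →
      ‖Complex.exp (-(N * p z₀)) * I‖ ≤ l * (K / P) := by
    intro I ε l hl hε hI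
    rw [norm_mul]
    calc ‖Complex.exp (-(N * p z₀))‖ * ‖I‖
        ≤ ‖Complex.exp (-(N * p z₀))‖ * (Real.exp (N * ((p z₀).re - ε)) * K * l) := by gcongr
      _ = Real.exp (-ε * N) * (K * l) := by rw [← hexp]; ring
      _ ≤ 1 / P * (K * l) := by gcongr
      _ = l * (K / P) := by ring
  have hE₁ := houter I₁ ε₁ l₁
    (intervalIntegral.integral_nonneg h0t₁.le fun t _ => norm_nonneg _)
    (hN₁ N hN ((le_max_left _ _).trans hNN)) hb₁'
  have hE₃ := houter I₃ ε₃ l₃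
    (intervalIntegral.integral_nonneg ht₂1.le fun t _ => norm_nonneg _)
    (hN₃ N hN ((le_max_right _ _).trans hNN)) hb₃'
  have hcast : ((2 * M : ℕ) : ℝ) = 2 * (M : ℝ) := by push_cast; ring
  rw [hcast, ← hP] at hW₁ hW₂
  -- The middle part equals `exp (N * p z₀) * (J₂ - J₁)` exactly, so the error consists of the
  -- rescaled outer parts and the two Watson remainders.
  refine ⟨Complex.exp (-(N * p z₀)) * I₁ + Complex.exp (-(N * p z₀)) * I₃ +
    ((J₂ - T₂) - (J₁ - T₁)), ?_, ?_⟩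
  · refine (norm_add_le_of_le (norm_add_le_of_le hE₁ hE₃) (norm_sub_le_of_le hW₂ hW₁)).trans
      (le_of_eq ?_)
    ring
  · rw [← hmain, Perron.contourIntegral, ← hsplit, hI₂']
    have h1 : Complex.exp (N * p z₀) * Complex.exp (-(N * p z₀)) = 1 := by
      rw [← Complex.exp_add, add_neg_cancel, Complex.exp_zero]
    linear_combination hseg₂ - hseg₁ - (I₁ + I₃) * h1
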